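/- Let $n\ge 2$ and $a\in\mathbb{R}$, and write $\mathbb{R}^n_+=\{x=(x_1,\dots,x_n)\in\mathbb{R}^n : x_n>0\}$, with closure $\overline{\mathbb{R}^n_+}=\{x_n\ge 0\}$ and boundary $\partial\mathbb{R}^n_+=\{x_n=0\}$. Let $u\in C^2(\mathbb{R}^n_+)\cap C^0(\overline{\mathbb{R}^n_+})$ be a real-valued function such that $$\operatorname{div}(x_n^a\nabla u)=0 \ \text{ and }\ u>-C \quad\text{in } \mathbb{R}^n_+ \text{ for some constant } C\in\mathbb{R}, \qquad u=0\quad\text{on }\partial\mathbb{R}^n_+ .$$ Then there is a constant $C_*\ge 0$ such that $u(x)=C_*\,x_n^{1-a}$ for all $x\in\mathbb{R}^n_+$. -/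

import Mathlib

open scoped Gradient

noncomputable section

/-- The index of the last coordinate of `ℝⁿ` for `n ≥ 2`. -/
def lastIdx {n : ℕ} (hn : 2 ≤ n) : Fin n := ⟨n - 1, by omega⟩

/-- The open upper half space `{x ∈ ℝⁿ : xₙ > 0}`. -/
def upperHalfSpace {n : ℕ} (hn : 2 ≤ n) : Set (EuclideanSpace ℝ (Fin n)) :=
  {x | 0 < x (lastIdx hn)}

/-- The closed upper half space `{x ∈ ℝⁿ : xₙ ≥ 0}`. -/
def closedUpperHalfSpace {n : ℕ} (hn : 2 ≤ n) : Set (EuclideanSpace ℝ (Fin n)) :=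
  {x | 0 ≤ x (lastIdx hn)}

/-- The boundary `{x ∈ ℝⁿ : xₙ = 0}` of the upper half space. -/
def upperHalfSpaceBoundary {n : ℕ} (hn : 2 ≤ n) : Set (EuclideanSpace ℝ (Fin n)) :=
  {x | x (lastIdx hn) = 0}

/-- The divergence `∑ᵢ ∂ᵢ Fᵢ` of a vector field on `ℝⁿ`. -/
def vectorDiv {n : ℕ} (F : EuclideanSpace ℝ (Fin n) → EuclideanSpace ℝ (Fin n))
    (x : EuclideanSpace ℝ (Fin n)) : ℝ :=
  ∑ i, fderiv ℝ (fun y => F y i) x (EuclideanSpace.single i 1)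

/-- The vector field `xₙᵃ ∇u`. -/
def weightedGradient {n : ℕ} (hn : 2 ≤ n) (a : ℝ) (u : EuclideanSpace ℝ (Fin n) → ℝ)
    (x : EuclideanSpace ℝ (Fin n)) : EuclideanSpace ℝ (Fin n) :=
  (x (lastIdx hn)) ^ a • ∇ u x

end

/-! The proof compares `u` with its Kelvin transforms about boundary points. In the open half space
the equation reads `L u = 0` with `L = Δ + (a / xₘ) ∂ₘ`. If `2 * q = 2 - n - a`, then `(‖x‖² / μ) ^
q * v (μ x / ‖x‖²)` again solves `L = 0` whenever `v` does (`HasWeightedLaplacianAt.kelvin`):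
inversion in a sphere centred on the boundary preserves the half space, and `a` acts like extra
dimensions.

A maximum principle shows that outside the sphere the transform lies below `v`
(`kelvinTransform_le`). The lower bound on `v` and its continuity at the centre control infinity, up
to a small multiple of a solution serving as barrier.

Given `y` higher than `z`, the line through them meets the boundary at a point `c`, and a sphere
centred at `c` exchanges `y` and `z`. Hence `(yₘ / zₘ) ^ q * v z ≤ v y` (`rpow_mul_le_of_apply_lt`).
As the two heights merge the factor tends to 1, so by symmetry `v` depends on `xₘ` only
(`eq_of_apply_eq`). What remains is the equation `f'' = -(a / t) f'` on the half line, with limit 0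
at 0 and a lower bound (`exists_eq_mul_rpow_of_ode`). -/

open Filter Topology

/-! ### Second-order calculus in one variable -/

/-- `g` is differentiable near `0`, with first and second derivatives `d₁`, `d₂` at `0`. -/
def HasTwoDerivs {F : Type*} [NormedAddCommGroup F] [NormedSpace ℝ F] (g : ℝ → F) (d₁ d₂ : F) :
    Prop :=
  ∃ g' : ℝ → F, (∀ᶠ t in 𝓝 0, HasDerivAt g (g' t) t) ∧ g' 0 = d₁ ∧ HasDerivAt g' d₂ 0

namespace HasTwoDerivs

variable {F G : Type*} [NormedAddCommGroup F] [NormedSpace ℝ F] [NormedAddCommGroup G]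
  [NormedSpace ℝ G]

theorem const (c : F) : HasTwoDerivs (fun _ => c) 0 0 :=
  ⟨fun _ => 0, .of_forall fun t => hasDerivAt_const t c, rfl, hasDerivAt_const 0 0⟩

theorem line (x v : F) : HasTwoDerivs (fun t : ℝ => x + t • v) v 0 :=
  ⟨fun _ => v, .of_forall fun t => by
    simpa using ((hasDerivAt_id t).smul_const v).const_add x, rfl, hasDerivAt_const 0 v⟩

theorem add {g h : ℝ → F} {d₁ d₂ e₁ e₂ : F} (hg : HasTwoDerivs g d₁ d₂)
    (hh : HasTwoDerivs h e₁ e₂) : HasTwoDerivs (fun t => g t + h t) (d₁ + e₁) (d₂ + e₂) := by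
  obtain ⟨g', hg1, rfl, hg3⟩ := hg
  obtain ⟨h', hh1, rfl, hh3⟩ := hh
  exact ⟨fun t => g' t + h' t, by filter_upwards [hg1, hh1] with t h1 h2 using h1.add h2, rfl,
    hg3.add hh3⟩

theorem smul {s : ℝ → ℝ} {g : ℝ → F} {s₁ s₂ : ℝ} {d₁ d₂ : F} (hs : HasTwoDerivs s s₁ s₂)
    (hg : HasTwoDerivs g d₁ d₂) :
    HasTwoDerivs (fun t => s t • g t) (s 0 • d₁ + s₁ • g 0)
      (s 0 • d₂ + (2 * s₁) • d₁ + s₂ • g 0) := by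
  obtain ⟨g', hg1, rfl, hg3⟩ := hg
  obtain ⟨s', hs1, rfl, hs3⟩ := hs
  refine ⟨fun t => s t • g' t + s' t • g t, ?_, rfl, ?_⟩
  · filter_upwards [hg1, hs1] with t h1 h2 using h2.smul h1
  · have h := (hs1.self_of_nhds.smul hg3).add (hs3.smul hg1.self_of_nhds)
    exact h.congr_deriv (by module)

theorem mul {s g : ℝ → ℝ} {s₁ s₂ d₁ d₂ : ℝ} (hs : HasTwoDerivs s s₁ s₂)
    (hg : HasTwoDerivs g d₁ d₂) :
    HasTwoDerivs (fun t => s t * g t) (s 0 * d₁ + s₁ * g 0)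
      (s 0 * d₂ + 2 * s₁ * d₁ + s₂ * g 0) := by
  simpa using hs.smul hg

theorem const_mul {g : ℝ → ℝ} {d₁ d₂ : ℝ} (c : ℝ) (hg : HasTwoDerivs g d₁ d₂) :
    HasTwoDerivs (fun t => c * g t) (c * d₁) (c * d₂) := by
  simpa using (HasTwoDerivs.const c).mul hg

theorem continuousAt {g : ℝ → F} {d₁ d₂ : F} (hg : HasTwoDerivs g d₁ d₂) : ContinuousAt g 0 := by
  obtain ⟨g', hg1, -, -⟩ := hg
  exact hg1.self_of_nhds.continuousAt

theorem scomp {φ φ' : ℝ → ℝ} {φ'' : ℝ} {g : ℝ → ℝ} {d₁ d₂ : ℝ} (hg : HasTwoDerivs g d₁ d₂)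
    (h1 : ∀ᶠ s in 𝓝 (g 0), HasDerivAt φ (φ' s) s) (h2 : HasDerivAt φ' φ'' (g 0)) :
    HasTwoDerivs (fun t => φ (g t)) (φ' (g 0) * d₁) (φ'' * d₁ ^ 2 + φ' (g 0) * d₂) := by
  have hc := hg.continuousAt
  obtain ⟨g', hg1, rfl, hg3⟩ := hg
  refine ⟨fun t => φ' (g t) * g' t, ?_, rfl, ?_⟩
  · filter_upwards [hg1, hc.eventually h1] with t ht1 ht2 using ht2.comp t ht1
  · have h := (h2.comp 0 hg1.self_of_nhds).mul hg3
    exact h.congr_deriv (by simp only [Function.comp]; ring)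

theorem comp {v : F → G} {g : ℝ → F} {d₁ d₂ : F} (hg : HasTwoDerivs g d₁ d₂)
    (hv : ContDiffAt ℝ 2 v (g 0)) :
    HasTwoDerivs (fun t => v (g t)) (fderiv ℝ v (g 0) d₁)
      (fderiv ℝ (fderiv ℝ v) (g 0) d₁ d₁ + fderiv ℝ v (g 0) d₂) := by
  have hc := hg.continuousAt
  obtain ⟨g', hg1, rfl, hg3⟩ := hg
  have hev : ∀ᶠ z in 𝓝 (g 0), HasFDerivAt v (fderiv ℝ v z) z := by
    filter_upwards [hv.eventually (by simp)] with z hz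
    exact (hz.differentiableAt (by simp)).hasFDerivAt
  have h2 : HasFDerivAt (fderiv ℝ v) (fderiv ℝ (fderiv ℝ v) (g 0)) (g 0) :=
    ((hv.fderiv_right (m := 1) (by norm_num [one_add_one_eq_two])).differentiableAt
      (by simp)).hasFDerivAt
  refine ⟨fun t => fderiv ℝ v (g t) (g' t), ?_, rfl, ?_⟩
  · filter_upwards [hg1, hc.eventually hev] with t ht1 ht2 using ht2.comp_hasDerivAt t ht1
  · exact (h2.comp_hasDerivAt 0 hg1.self_of_nhds).clm_apply hg3

theorem eq_zero_of_isLocalMin {g : ℝ → ℝ} {d₁ d₂ : ℝ} (hg : HasTwoDerivs g d₁ d₂)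
    (hmin : IsLocalMin g 0) : d₁ = 0 := by
  obtain ⟨g', hg1, rfl, hg3⟩ := hg
  exact hmin.hasDerivAt_eq_zero hg1.self_of_nhds

theorem nonneg_of_isLocalMin {g : ℝ → ℝ} {d₁ d₂ : ℝ} (hg : HasTwoDerivs g d₁ d₂)
    (hmin : IsLocalMin g 0) : 0 ≤ d₂ := by
  have h0 := hg.eq_zero_of_isLocalMin hmin
  have hc := hg.continuousAt
  obtain ⟨g', hg1, h1, hg3⟩ := hg
  by_contra! hneg
  have hd : deriv g =ᶠ[𝓝 0] g' := by filter_upwards [hg1] with t ht using ht.deriv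
  have hdd : deriv (deriv g) 0 = d₂ := by rw [hd.deriv_eq, hg3.deriv]
  -- A negative second derivative would make 0 a local maximum as well, so `g` would be locally
  -- constant and its second derivative would vanish.
  have hmax : IsLocalMax g 0 := isLocalMax_of_deriv_deriv_neg (by rw [hdd]; exact hneg)
    (by rw [hd.self_of_nhds, h1, h0]) hc
  have hconst : g =ᶠ[𝓝 0] fun _ => g 0 := by
    filter_upwards [hmin, hmax] with t h1 h2 using le_antisymm h2 h1
  have : deriv (deriv g) 0 = 0 := by
    rw [hconst.deriv.deriv_eq]; simp
  linarith

end HasTwoDerivs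

/-! ### The weighted Laplacian and its minimum principle -/

/-- The operator `Δ + (a / xₘ) ∂ₘ`, computed along coordinate lines, takes the value `l` on `f`
at `x`. -/
def HasWeightedLaplacianAt {n : ℕ} (a : ℝ) (m : Fin n) (f : EuclideanSpace ℝ (Fin n) → ℝ)
    (l : ℝ) (x : EuclideanSpace ℝ (Fin n)) : Prop :=
  ∃ d₁ d₂ : Fin n → ℝ,
    (∀ i, HasTwoDerivs (fun t : ℝ => f (x + t • EuclideanSpace.single i 1)) (d₁ i) (d₂ i)) ∧
    ∑ i, d₂ i + a / x m * d₁ m = l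

namespace HasWeightedLaplacianAt

variable {n : ℕ} {a : ℝ} {m : Fin n} {f g : EuclideanSpace ℝ (Fin n) → ℝ} {k l : ℝ}
  {x : EuclideanSpace ℝ (Fin n)}

theorem const (c : ℝ) : HasWeightedLaplacianAt a m (fun _ => c) 0 x :=
  ⟨0, 0, fun _ => HasTwoDerivs.const c, by simp⟩

theorem add (hf : HasWeightedLaplacianAt a m f k x) (hg : HasWeightedLaplacianAt a m g l x) :
    HasWeightedLaplacianAt a m (fun y => f y + g y) (k + l) x := by
  obtain ⟨d₁, d₂, h, rfl⟩ := hf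
  obtain ⟨e₁, e₂, h', rfl⟩ := hg
  refine ⟨d₁ + e₁, d₂ + e₂, fun i => (h i).add (h' i), ?_⟩
  simp only [Pi.add_apply, Finset.sum_add_distrib]
  ring

theorem const_mul (c : ℝ) (hf : HasWeightedLaplacianAt a m f k x) :
    HasWeightedLaplacianAt a m (fun y => c * f y) (c * k) x := by
  obtain ⟨d₁, d₂, h, rfl⟩ := hf
  refine ⟨fun i => c * d₁ i, fun i => c * d₂ i, fun i => (h i).const_mul c, ?_⟩
  simp only [← Finset.mul_sum]
  ring

/-- A tangential square is not seen by the drift `(a / xₘ) ∂ₘ`; subtracting it turns a solution into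
a strict supersolution for every `a`. -/
theorem sq_apply {j : Fin n} (hj : j ≠ m) :
    HasWeightedLaplacianAt a m (fun y => y j ^ 2) 2 x := by
  refine ⟨fun i => if i = j then 2 * x j else 0, fun i => if i = j then 2 else 0, fun i => ?_, ?_⟩
  · by_cases h : i = j
    · subst h
      have := (HasTwoDerivs.line (x i) (1 : ℝ))
      have := this.mul this
      simp only [if_true]
      convert this using 1
      · ext t; simp; ring
      · simp; ring
      · simp
    · have : (fun t : ℝ => (x + t • EuclideanSpace.single i (1 : ℝ)) j ^ 2) = fun _ => x j ^ 2 := by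
        ext t; simp [Ne.symm h]
      rw [this]
      simpa [h] using HasTwoDerivs.const (x j ^ 2)
  · simp [hj.symm]

/-- At a local minimum the drift term vanishes and every pure second derivative is nonnegative, so
the sign of `a` plays no role. -/
theorem not_isLocalMin (hf : HasWeightedLaplacianAt a m f l x) (hl : l < 0) :
    ¬ IsLocalMin f x := by
  intro hmin
  obtain ⟨d₁, d₂, h, rfl⟩ := hf
  have hm : ∀ i, IsLocalMin (fun t : ℝ => f (x + t • EuclideanSpace.single i 1)) 0 := by
    intro i
    have hc : Tendsto (fun t : ℝ => x + t • EuclideanSpace.single i (1 : ℝ)) (𝓝 0) (𝓝 x) := by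
      have : Continuous (fun t : ℝ => x + t • EuclideanSpace.single i (1 : ℝ)) := by fun_prop
      simpa using this.tendsto 0
    have := hc.eventually hmin
    simpa [IsLocalMin, IsMinFilter] using this
  have h1 := (h m).eq_zero_of_isLocalMin (hm m)
  have h2 : 0 ≤ ∑ i, d₂ i := Finset.sum_nonneg fun i _ => (h i).nonneg_of_isLocalMin (hm i)
  rw [h1] at hl
  linarith

end HasWeightedLaplacianAt

/-! ### Radial solutions and invariance under the Kelvin transform -/

section Calculus

variable {n : ℕ} {a : ℝ} {m : Fin n} {x : EuclideanSpace ℝ (Fin n)}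

theorem HasTwoDerivs.norm_sq_line (x : EuclideanSpace ℝ (Fin n)) (i : Fin n) :
    HasTwoDerivs (fun t : ℝ => ‖x + t • EuclideanSpace.single i (1 : ℝ)‖ ^ 2) (2 * x i) 2 := by
  have h : (fun t : ℝ => ‖x + t • EuclideanSpace.single i (1 : ℝ)‖ ^ 2) =
      fun t => ‖x‖ ^ 2 + (0 + t • (1 : ℝ)) * (2 * x i + t • (1 : ℝ)) := by
    ext t
    rw [norm_add_sq_real, inner_smul_right, norm_smul, EuclideanSpace.inner_single_right,
      mul_pow]
    simp
    ring
  rw [h]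
  have := (HasTwoDerivs.const (‖x‖ ^ 2)).add
    ((HasTwoDerivs.line (0 : ℝ) (1 : ℝ)).mul (HasTwoDerivs.line (2 * x i) (1 : ℝ)))
  convert this using 1 <;> simp

theorem HasTwoDerivs.radial {φ φ' : ℝ → ℝ} {φ'' : ℝ} (x : EuclideanSpace ℝ (Fin n))
    (h1 : ∀ᶠ s in 𝓝 (‖x‖ ^ 2), HasDerivAt φ (φ' s) s) (h2 : HasDerivAt φ' φ'' (‖x‖ ^ 2))
    (i : Fin n) :
    HasTwoDerivs (fun t : ℝ => φ (‖x + t • EuclideanSpace.single i (1 : ℝ)‖ ^ 2))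
      (φ' (‖x‖ ^ 2) * (2 * x i)) (φ'' * (2 * x i) ^ 2 + φ' (‖x‖ ^ 2) * 2) := by
  have := (HasTwoDerivs.norm_sq_line x i).scomp (φ := φ) (φ' := φ') (φ'' := φ'')
    (by simpa using h1) (by simpa using h2)
  simpa using this

theorem sum_sq_apply (x : EuclideanSpace ℝ (Fin n)) : ∑ i, x i ^ 2 = ‖x‖ ^ 2 := by
  rw [EuclideanSpace.real_norm_sq_eq]

theorem HasWeightedLaplacianAt.radial {φ φ' : ℝ → ℝ} {φ'' : ℝ} (hm : x m ≠ 0)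
    (h1 : ∀ᶠ s in 𝓝 (‖x‖ ^ 2), HasDerivAt φ (φ' s) s) (h2 : HasDerivAt φ' φ'' (‖x‖ ^ 2)) :
    HasWeightedLaplacianAt a m (fun y => φ (‖y‖ ^ 2))
      (4 * ‖x‖ ^ 2 * φ'' + 2 * (n + a) * φ' (‖x‖ ^ 2)) x := by
  refine ⟨_, _, HasTwoDerivs.radial x h1 h2, ?_⟩
  rw [Finset.sum_add_distrib, ← Finset.mul_sum]
  simp only [mul_pow, ← Finset.mul_sum, sum_sq_apply]
  simp
  field_simp
  ring

theorem eventually_hasDerivAt_rpow (q : ℝ) {s : ℝ} (hs : 0 < s) :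
    ∀ᶠ r in 𝓝 s, HasDerivAt (fun r : ℝ => r ^ q) (q * r ^ (q - 1)) r := by
  filter_upwards [lt_mem_nhds hs] with r hr
  exact Real.hasDerivAt_rpow_const (Or.inl hr.ne')

theorem hasDerivAt_deriv_rpow (q : ℝ) {s : ℝ} (hs : 0 < s) :
    HasDerivAt (fun r : ℝ => q * r ^ (q - 1)) (q * (q - 1) * s ^ q / s ^ 2) s := by
  refine ((Real.hasDerivAt_rpow_const (p := q - 1) (Or.inl hs.ne')).const_mul q).congr_deriv ?_
  rw [show q - 1 - 1 = q - 2 by ring, Real.rpow_sub hs]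
  norm_num
  ring

/-- On radial functions `L` is the Laplacian in dimension `n + a`, so this is its fundamental
solution; it serves as barrier when `0 < q`, and the logarithm replaces it when `q = 0`. -/
theorem HasWeightedLaplacianAt.norm_sq_rpow (hm : 0 < x m) {q : ℝ} (hq : 2 * q = 2 - n - a) :
    HasWeightedLaplacianAt a m (fun y => (‖y‖ ^ 2) ^ q) 0 x := by
  have hx : 0 < ‖x‖ ^ 2 := by
    have : x ≠ 0 := by rintro rfl; simp at hm
    positivity
  have := HasWeightedLaplacianAt.radial (a := a) hm.ne' (eventually_hasDerivAt_rpow q hx)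
    (hasDerivAt_deriv_rpow q hx)
  convert this using 1
  rw [Real.rpow_sub hx, Real.rpow_one, show (a : ℝ) = 2 - n - 2 * q by linarith]
  field_simp
  ring

theorem HasWeightedLaplacianAt.log_norm_sq (hm : 0 < x m) (hna : (n : ℝ) + a = 2) :
    HasWeightedLaplacianAt a m (fun y => Real.log (‖y‖ ^ 2)) 0 x := by
  have hx : 0 < ‖x‖ ^ 2 := by
    have : x ≠ 0 := by rintro rfl; simp at hm
    positivity
  have := HasWeightedLaplacianAt.radial (a := a) (φ := Real.log) (φ' := fun s => s⁻¹) hm.ne'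
    (by filter_upwards [lt_mem_nhds hx] with r hr using Real.hasDerivAt_log hr.ne')
    (hasDerivAt_inv hx.ne')
  convert this using 1
  rw [hna]
  field_simp
  ring

theorem sum_apply_smul_single (x : EuclideanSpace ℝ (Fin n)) :
    ∑ i, x i • EuclideanSpace.single i (1 : ℝ) = x := by
  simpa using (EuclideanSpace.basisFun (Fin n) ℝ).sum_repr x

/-- The weighted Laplacian `(Δ + (a / xₘ) ∂ₘ) v`. -/
noncomputable def weightedLaplacian (a : ℝ) (m : Fin n) (v : EuclideanSpace ℝ (Fin n) → ℝ)
    (x : EuclideanSpace ℝ (Fin n)) : ℝ :=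
  ∑ i, fderiv ℝ (fderiv ℝ v) x (EuclideanSpace.single i 1) (EuclideanSpace.single i 1) +
    a / x m * fderiv ℝ v x (EuclideanSpace.single m 1)

theorem ContDiffAt.hasWeightedLaplacianAt {v : EuclideanSpace ℝ (Fin n) → ℝ}
    (hv : ContDiffAt ℝ 2 v x) :
    HasWeightedLaplacianAt a m v (weightedLaplacian a m v x) x := by
  refine ⟨_, _, fun i =>
    (HasTwoDerivs.line x (EuclideanSpace.single i 1)).comp (by simpa using hv), ?_⟩
  simp [weightedLaplacian]

/-- Differentiate twice along each coordinate line and sum. The trace of the Hessian is eliminated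
by the equation at the inverted point, and the remaining terms in `v`, `U x`, `Q x x` and `U eₘ`
cancel by the choice of `q`. -/
theorem HasWeightedLaplacianAt.kelvin {v : EuclideanSpace ℝ (Fin n) → ℝ} {μ : ℝ} (hμ : 0 < μ)
    (hm : 0 < x m) (hv : ContDiffAt ℝ 2 v ((μ / ‖x‖ ^ 2) • x))
    (h0 : weightedLaplacian a m v ((μ / ‖x‖ ^ 2) • x) = 0) {q : ℝ} (hq : 2 * q = 2 - n - a) :
    HasWeightedLaplacianAt a m (fun y => (‖y‖ ^ 2) ^ q * v ((μ / ‖y‖ ^ 2) • y)) 0 x := by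
  have hρ : 0 < ‖x‖ ^ 2 := by
    have : x ≠ 0 := by rintro rfl; simp at hm
    positivity
  have hs1 : ∀ᶠ s in 𝓝 (‖x‖ ^ 2), HasDerivAt (fun s : ℝ => μ / s) (-μ / s ^ 2) s := by
    filter_upwards [lt_mem_nhds hρ] with r hr
    refine ((hasDerivAt_inv hr.ne').const_mul μ).congr_deriv (by ring)
  have hs2 : HasDerivAt (fun s : ℝ => -μ / s ^ 2) (2 * μ / (‖x‖ ^ 2) ^ 3) (‖x‖ ^ 2) := by
    have := ((hasDerivAt_pow 2 (‖x‖ ^ 2)).inv (by positivity)).const_mul (-μ)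
    refine this.congr_deriv ?_
    norm_num
    field_simp
  have hJ := fun i => (HasTwoDerivs.radial x hs1 hs2 i).smul
    (HasTwoDerivs.line x (EuclideanSpace.single i (1 : ℝ)))
  have hvJ := fun i => (hJ i).comp (v := v) (by simpa using hv)
  have hK := fun i => (HasTwoDerivs.radial x (eventually_hasDerivAt_rpow q hρ)
    (hasDerivAt_deriv_rpow q hρ) i).mul (hvJ i)
  refine ⟨_, _, hK, ?_⟩
  simp only [zero_smul, add_zero, smul_zero, zero_add, map_add, map_smul, smul_eq_mul,
    add_apply, smul_apply]
  rw [weightedLaplacian] at h0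
  simp only [PiLp.smul_apply, smul_eq_mul] at h0
  set z := (μ / ‖x‖ ^ 2) • x
  set ρ := ‖x‖ ^ 2 with hρdef
  set Q := fderiv ℝ (fderiv ℝ v) z
  set U := fderiv ℝ v z
  rw [Real.rpow_sub hρ, Real.rpow_one]
  set A := ρ ^ q
  have e1 : ∑ i, x i * U (EuclideanSpace.single i 1) = U x := by
    conv_rhs => rw [← sum_apply_smul_single x]
    simp
  have e2 : ∑ i, x i * Q x (EuclideanSpace.single i 1) = Q x x := by
    conv_rhs => arg 2; rw [← sum_apply_smul_single x]
    simp
  have e3 : ∑ i, x i * Q (EuclideanSpace.single i 1) x = Q x x := by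
    conv_rhs => arg 1; arg 2; rw [← sum_apply_smul_single x]
    simp
  have e4 : ∑ i, x i ^ 2 = ρ := sum_sq_apply x
  have hS : ∑ i, Q (EuclideanSpace.single i 1) (EuclideanSpace.single i 1) =
      -(a / (μ / ρ * x m) * U (EuclideanSpace.single m 1)) := by linarith
  -- Each second derivative is grouped by its dependence on `i`, so that `e1`–`e4` and `hS` evaluate
  -- the sum.
  rw [Finset.sum_congr (g := fun i => (2 * q * A / ρ * v z - 2 * A * μ / ρ ^ 2 * U x)
      + (4 * q * (q - 1) * A / ρ ^ 2 * v z + 4 * A * μ ^ 2 / ρ ^ 4 * Q x x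
          + (8 - 8 * q) * A * μ / ρ ^ 3 * U x) * x i ^ 2
      + (4 * q - 4) * A * μ / ρ ^ 2 * (x i * U (EuclideanSpace.single i 1))
      + -2 * A * μ ^ 2 / ρ ^ 3 * (x i * Q x (EuclideanSpace.single i 1))
      + -2 * A * μ ^ 2 / ρ ^ 3 * (x i * Q (EuclideanSpace.single i 1) x)
      + A * μ ^ 2 / ρ ^ 2 * Q (EuclideanSpace.single i 1) (EuclideanSpace.single i 1)) rfl
      fun i _ => by field_simp; ring]
  simp only [Finset.sum_add_distrib, ← Finset.mul_sum, e1, e2, e3, e4, hS, Finset.sum_const,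
    Finset.card_univ, Fintype.card_fin, nsmul_eq_mul]
  rw [show a = 2 - n - 2 * q by linarith]
  field_simp
  ring

end Calculus

/-! ### Comparison with the Kelvin transform outside a sphere -/

section Comparison

variable {n : ℕ} {a : ℝ} {j m : Fin n} {v : EuclideanSpace ℝ (Fin n) → ℝ} {q μ : ℝ}

/-- The Kelvin transform of `v` with respect to the sphere of radius `√μ` centred at the origin;
it preserves solutions of the weighted equation when `2 * q = 2 - n - a`. -/
noncomputable def kelvinTransform (q μ : ℝ) (v : EuclideanSpace ℝ (Fin n) → ℝ)
    (x : EuclideanSpace ℝ (Fin n)) : ℝ :=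
  (‖x‖ ^ 2 / μ) ^ q * v ((μ / ‖x‖ ^ 2) • x)

theorem nonneg_of_forall_pos_add_mul {A B : ℝ} (h : ∀ ε > 0, 0 ≤ A + ε * B) : 0 ≤ A := by
  have ht : Tendsto (fun ε : ℝ => A + ε * B) (𝓝[>] 0) (𝓝 (A + 0 * B)) :=
    (Continuous.tendsto (by fun_prop) 0).mono_left nhdsWithin_le_nhds
  rw [zero_mul, add_zero] at ht
  exact ge_of_tendsto ht (eventually_mem_nhdsWithin.mono fun ε hε => h ε hε)

theorem kelvinTransform_eq (hμ : 0 < μ) (x : EuclideanSpace ℝ (Fin n)) :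
    kelvinTransform q μ v x = (μ ^ q)⁻¹ * ((‖x‖ ^ 2) ^ q * v ((μ / ‖x‖ ^ 2) • x)) := by
  rw [kelvinTransform, Real.div_rpow (by positivity) hμ.le]
  ring

theorem continuousOn_kelvinTransform (hμ : 0 < μ) (hv : ContinuousOn v {x | 0 ≤ x m}) :
    ContinuousOn (kelvinTransform q μ v) {x | 0 ≤ x m ∧ x ≠ 0} := by
  have hne : ∀ x ∈ {x : EuclideanSpace ℝ (Fin n) | 0 ≤ x m ∧ x ≠ 0}, ‖x‖ ^ 2 ≠ 0 := by
    intro x hx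
    simpa using hx.2
  refine ContinuousOn.mul (ContinuousOn.rpow_const (by fun_prop) fun x hx => Or.inl ?_) ?_
  · exact div_ne_zero (hne x hx) hμ.ne'
  · refine hv.comp (ContinuousOn.smul (continuousOn_const.div (by fun_prop) hne) continuousOn_id) ?_
    intro x hx
    have := hx.1
    simp only [Set.mem_ofPred_eq, PiLp.smul_apply, smul_eq_mul]
    positivity

/-- Minimum principle on a half annulus: `ε * b` secures the outer sphere, and `δ * (R² - xⱼ²)`
makes the supersolution strict. First `δ → 0` with `ε` and `R` fixed, then `ε → 0`. -/
theorem kelvinTransform_le_of_barrier (hj : j ≠ m) (hμ : 0 < μ) (hq : 2 * q = 2 - n - a)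
    (hsm : ∀ x, 0 < x m → ContDiffAt ℝ 2 v x) (hc : ContinuousOn v {x | 0 ≤ x m})
    (hL : ∀ x, 0 < x m → weightedLaplacian a m v x = 0)
    (hbd : ∀ x, x m = 0 → μ ≤ ‖x‖ ^ 2 → kelvinTransform q μ v x ≤ v x)
    {b : EuclideanSpace ℝ (Fin n) → ℝ} (hbc : ContinuousOn b {x | x ≠ 0})
    (hbL : ∀ x, 0 < x m → HasWeightedLaplacianAt a m b 0 x)
    (hb0 : ∀ x, μ ≤ ‖x‖ ^ 2 → 0 ≤ b x)
    (hinf : ∀ ε > 0, ∃ R : ℝ, ∀ x, 0 ≤ x m → R ≤ ‖x‖ →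
      0 ≤ v x - kelvinTransform q μ v x + ε * b x)
    {x : EuclideanSpace ℝ (Fin n)} (hx : 0 ≤ x m) (hxμ : μ ≤ ‖x‖ ^ 2) :
    kelvinTransform q μ v x ≤ v x := by
  suffices h : ∀ ε > 0, 0 ≤ (v x - kelvinTransform q μ v x) + ε * b x from
    sub_nonneg.1 (nonneg_of_forall_pos_add_mul h)
  intro ε hε
  obtain ⟨R₀, hR₀⟩ := hinf ε hε
  set R := max R₀ ‖x‖
  suffices h : ∀ δ > 0, 0 ≤ ((v x - kelvinTransform q μ v x) + ε * b x) + δ * (R ^ 2 - x j ^ 2) from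
    nonneg_of_forall_pos_add_mul h
  intro δ hδ
  set f : EuclideanSpace ℝ (Fin n) → ℝ := fun y =>
    ((v y - kelvinTransform q μ v y) + ε * b y) + δ * (R ^ 2 - y j ^ 2) with hf
  set D : Set (EuclideanSpace ℝ (Fin n)) := {y | 0 ≤ y m ∧ μ ≤ ‖y‖ ^ 2 ∧ ‖y‖ ≤ R} with hD
  have hDne : ∀ y ∈ D, y ≠ 0 := by
    rintro y hy rfl
    have := hy.2.1
    simp at this
    linarith
  have hDc : IsCompact D := by
    refine (isCompact_closedBall (0 : EuclideanSpace ℝ (Fin n)) R).of_isClosed_subset ?_ ?_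
    · have c1 : IsClosed {y : EuclideanSpace ℝ (Fin n) | 0 ≤ y m} :=
        isClosed_le continuous_const (by fun_prop)
      have c2 : IsClosed {y : EuclideanSpace ℝ (Fin n) | μ ≤ ‖y‖ ^ 2} :=
        isClosed_le continuous_const (by fun_prop)
      have c3 : IsClosed {y : EuclideanSpace ℝ (Fin n) | ‖y‖ ≤ R} :=
        isClosed_le (by fun_prop) continuous_const
      exact c1.inter (c2.inter c3)
    · intro y hy
      simpa using hy.2.2
  have hfc : ContinuousOn f D := by
    refine ((ContinuousOn.sub (hc.mono fun y hy => hy.1) ?_).add (continuousOn_const.mul ?_)).add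
      (by fun_prop)
    · exact (continuousOn_kelvinTransform hμ hc).mono fun y hy => ⟨hy.1, hDne y hy⟩
    · exact hbc.mono hDne
  have hxD : x ∈ D := ⟨hx, hxμ, le_max_right _ _⟩
  obtain ⟨y, hyD, hy⟩ := hDc.exists_isMinOn ⟨x, hxD⟩ hfc
  refine le_trans ?_ (hy hxD)
  have hj2 : 0 ≤ δ * (R ^ 2 - y j ^ 2) := by
    have h1 : y j ^ 2 ≤ ‖y‖ ^ 2 := by
      rw [← sum_sq_apply y]
      exact Finset.single_le_sum (f := fun i => y i ^ 2) (fun i _ => sq_nonneg _)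
        (Finset.mem_univ j)
    have h2 : ‖y‖ ^ 2 ≤ R ^ 2 := pow_le_pow_left₀ (norm_nonneg y) hyD.2.2 2
    exact mul_nonneg hδ.le (by linarith)
  have hεb : 0 ≤ ε * b y := mul_nonneg hε.le (hb0 y hyD.2.1)
  -- The minimiser `y` may lie on the flat boundary, on the inner sphere (fixed by the inversion) or
  -- on the outer sphere; each gives `0 ≤ f y`. In the interior, `L f = -2δ < 0` forbids a minimum.
  rcases hyD.1.eq_or_lt with h0 | h0
  · have := hbd y h0.symm hyD.2.1
    simp only [hf]
    linarith
  rcases hyD.2.1.eq_or_lt with h1 | h1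
  · have : kelvinTransform q μ v y = v y := by
      rw [kelvinTransform, ← h1, div_self hμ.ne', Real.one_rpow, one_smul, one_mul]
    simp only [hf]
    linarith
  rcases hyD.2.2.eq_or_lt with h2 | h2
  · have := hR₀ y hyD.1 (h2 ▸ le_max_left _ _)
    simp only [hf]
    linarith
  exfalso
  have hnhds : D ∈ 𝓝 y := by
    filter_upwards [(isOpen_lt continuous_const (by fun_prop : Continuous fun z :
        EuclideanSpace ℝ (Fin n) => z m)).mem_nhds h0,
      (isOpen_lt continuous_const (by fun_prop : Continuous fun z :
        EuclideanSpace ℝ (Fin n) => ‖z‖ ^ 2)).mem_nhds h1,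
      (isOpen_lt (by fun_prop : Continuous fun z :
        EuclideanSpace ℝ (Fin n) => ‖z‖) continuous_const).mem_nhds h2] with z hz0 hz1 hz2
    exact ⟨le_of_lt hz0, le_of_lt hz1, le_of_lt hz2⟩
  have hJ : 0 < ((μ / ‖y‖ ^ 2) • y) m := by
    have : 0 < ‖y‖ ^ 2 := hμ.trans h1
    simp only [PiLp.smul_apply, smul_eq_mul]
    positivity
  have hop := (((hsm y h0).hasWeightedLaplacianAt (a := a) (m := m)).add
    ((HasWeightedLaplacianAt.kelvin hμ h0 (hsm _ hJ) (hL _ hJ) hq).const_mul (-(μ ^ q)⁻¹))).add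
    ((hbL y h0).const_mul ε) |>.add ((HasWeightedLaplacianAt.const (δ * R ^ 2)).add
      ((HasWeightedLaplacianAt.sq_apply hj).const_mul (-δ)))
  refine hop.not_isLocalMin (by rw [hL y h0]; linarith)
    ((congrArg (IsLocalMin · y) (funext fun z => ?_)).mpr (hy.isLocalMin hnhds))
  simp only [hf, kelvinTransform_eq hμ]
  ring

/-- Inversion sends far points close to the centre, where continuity up to the boundary bounds `v`;
no upper bound on `v` at infinity is needed. -/
theorem eventually_comp_inversion_le {k : ℝ} (hc : ContinuousOn v {x | 0 ≤ x m}) (hμ : 0 < μ)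
    (h0 : v 0 = k) {η : ℝ} (hη : 0 < η) :
    ∀ᶠ r : ℝ in atTop, ∀ x : EuclideanSpace ℝ (Fin n), 0 ≤ x m → ‖x‖ = r →
      v ((μ / ‖x‖ ^ 2) • x) ≤ k + η := by
  have h := (hc 0 (by simp)).eventually (gt_mem_nhds (show v 0 < k + η by linarith))
  obtain ⟨ρ, hρ, hball⟩ := Metric.mem_nhdsWithin_iff.1 h
  filter_upwards [eventually_gt_atTop 0, eventually_gt_atTop (μ / ρ)] with r hr0 hr x hx hxr
  refine le_of_lt (hball ⟨?_, ?_⟩)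
  · rw [mem_ball_zero_iff, norm_smul, hxr, Real.norm_of_nonneg (by positivity)]
    rw [div_lt_iff₀ hρ] at hr
    rw [show μ / r ^ 2 * r = μ / r by field_simp, div_lt_iff₀ hr0]
    linarith
  · simp only [Set.mem_ofPred_eq, PiLp.smul_apply, smul_eq_mul]
    positivity

theorem kelvinTransform_le (hj : j ≠ m) (hμ : 0 < μ) (hq : 2 * q = 2 - n - a) {k : ℝ}
    (hsm : ∀ x, 0 < x m → ContDiffAt ℝ 2 v x) (hc : ContinuousOn v {x | 0 ≤ x m})
    (hL : ∀ x, 0 < x m → weightedLaplacian a m v x = 0) (hbd : ∀ x, x m = 0 → v x = k)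
    (hk : (q < 0 ∧ 0 ≤ k ∧ ∀ x, 0 ≤ x m → 0 ≤ v x) ∨
      (0 ≤ q ∧ k = 0 ∧ ∃ C, ∀ x, 0 ≤ x m → -C ≤ v x))
    {x : EuclideanSpace ℝ (Fin n)} (hx : 0 ≤ x m) (hxμ : μ ≤ ‖x‖ ^ 2) :
    kelvinTransform q μ v x ≤ v x := by
  have hv0 : v 0 = k := hbd 0 (by simp)
  have hbd' : ∀ x, x m = 0 → μ ≤ ‖x‖ ^ 2 → kelvinTransform q μ v x ≤ v x := by
    intro y hy hyμ
    rw [kelvinTransform, hbd y hy, hbd _ (by simp [hy])]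
    rcases hk with ⟨hq0, hk0, -⟩ | ⟨-, rfl, -⟩
    · refine mul_le_of_le_one_left hk0 (Real.rpow_le_one_of_one_le_of_nonpos ?_ hq0.le)
      rwa [one_le_div hμ]
    · simp
  have hsq : Tendsto (fun r : ℝ => r ^ 2) atTop atTop := tendsto_pow_atTop two_ne_zero
  -- For `q < 0` the transform decays and `v ≥ 0`, so a constant barrier suffices. For `q ≥ 0` a
  -- barrier growing to infinity absorbs both `-C` and the transform.
  rcases hk with ⟨hq0, hk0, hpos⟩ | ⟨hq0, rfl, C, hC⟩
  · refine kelvinTransform_le_of_barrier hj hμ hq hsm hc hL hbd' (b := fun _ => 1)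
      continuousOn_const (fun _ _ => HasWeightedLaplacianAt.const 1) (fun _ _ => zero_le_one)
      (fun ε hε => ?_) hx hxμ
    have ht : Tendsto (fun r : ℝ => (r ^ 2 / μ) ^ q * (k + 1)) atTop (𝓝 (0 * (k + 1))) := by
      refine Tendsto.mul_const _ ?_
      have := (tendsto_rpow_neg_atTop (neg_pos.2 hq0)).comp (hsq.atTop_div_const hμ)
      simpa [Function.comp_def] using this
    rw [zero_mul] at ht
    obtain ⟨R, hR⟩ := eventually_atTop.1
      ((eventually_comp_inversion_le hc hμ hv0 zero_lt_one).and (ht.eventually (gt_mem_nhds hε)))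
    refine ⟨R, fun y hy hyR => ?_⟩
    obtain ⟨h1, h2⟩ := hR _ hyR
    have h3 : kelvinTransform q μ v y ≤ (‖y‖ ^ 2 / μ) ^ q * (k + 1) :=
      mul_le_mul_of_nonneg_left (h1 y hy rfl) (by positivity)
    linarith [hpos y hy]
  rcases hq0.eq_or_lt with rfl | hq0
  · refine kelvinTransform_le_of_barrier hj hμ hq hsm hc hL hbd'
      (b := fun y => Real.log (‖y‖ ^ 2) + -Real.log μ) ?_ (fun y hy => ?_) (fun y hy => ?_)
      (fun ε hε => ?_) hx hxμ
    · exact ContinuousOn.add (ContinuousOn.log (by fun_prop) fun y hy => by simpa using hy)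
        continuousOn_const
    · simpa using (HasWeightedLaplacianAt.log_norm_sq hy (by linarith)).add
        (HasWeightedLaplacianAt.const (-Real.log μ))
    · have := Real.log_le_log hμ hy
      linarith
    · have ht : Tendsto (fun r : ℝ => ε * (Real.log (r ^ 2) + -Real.log μ)) atTop atTop :=
        (tendsto_atTop_add_const_right _ _ (Real.tendsto_log_atTop.comp hsq)).const_mul_atTop hε
      obtain ⟨R, hR⟩ := eventually_atTop.1
        ((eventually_comp_inversion_le hc hμ hv0 zero_lt_one).and (ht.eventually_ge_atTop (C + 1)))
      refine ⟨R, fun y hy hyR => ?_⟩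
      obtain ⟨h1, h2⟩ := hR _ hyR
      have h3 := h1 y hy rfl
      rw [kelvinTransform, Real.rpow_zero, one_mul]
      linarith [hC y hy]
  · refine kelvinTransform_le_of_barrier hj hμ hq hsm hc hL hbd'
      (b := fun y => (‖y‖ ^ 2) ^ q) ?_ (fun y hy => .norm_sq_rpow hy hq) (fun y hy => by positivity)
      (fun ε hε => ?_) hx hxμ
    · exact ContinuousOn.rpow_const (by fun_prop) fun y hy => Or.inr hq0.le
    · have ht : Tendsto (fun r : ℝ => ε / 2 * (r ^ 2) ^ q) atTop atTop :=
        ((tendsto_rpow_atTop hq0).comp hsq).const_mul_atTop (half_pos hε)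
      -- Half of `ε * b` absorbs the transform, which is `o(‖y‖ ^ (2q))` since `v` vanishes at the
      -- centre; the other half absorbs `-C`.
      have hη : 0 < ε / 2 * μ ^ q := by positivity
      obtain ⟨R, hR⟩ := eventually_atTop.1
        ((eventually_comp_inversion_le hc hμ hv0 hη).and (ht.eventually_ge_atTop C))
      refine ⟨R, fun y hy hyR => ?_⟩
      obtain ⟨h1, h2⟩ := hR _ hyR
      have h3 : kelvinTransform q μ v y ≤ ε / 2 * (‖y‖ ^ 2) ^ q := by
        have hμq : 0 < μ ^ q := by positivity
        rw [kelvinTransform, Real.div_rpow (by positivity) hμ.le]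
        calc _ ≤ (‖y‖ ^ 2) ^ q / μ ^ q * (0 + ε / 2 * μ ^ q) :=
              mul_le_mul_of_nonneg_left (h1 y hy rfl) (by positivity)
          _ = _ := by field_simp; ring
      linarith [hC y hy]

end Comparison

/-! ### Spheres centred at arbitrary boundary points -/

section Translation

variable {n : ℕ} {a : ℝ} {j m : Fin n} {v : EuclideanSpace ℝ (Fin n) → ℝ} {q : ℝ}

theorem weightedLaplacian_comp_add_right (c x : EuclideanSpace ℝ (Fin n)) (hcm : c m = 0) :
    weightedLaplacian a m (fun y => v (y + c)) x = weightedLaplacian a m v (x + c) := by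
  have h : fderiv ℝ (fun y => v (y + c)) = fun y => fderiv ℝ v (y + c) := by
    ext1 y
    exact fderiv_comp_add_right c
  simp only [weightedLaplacian, h, PiLp.add_apply, hcm, add_zero]
  rw [fderiv_comp_add_right c]

theorem weightedLaplacian_add_const (k : ℝ) :
    weightedLaplacian a m (fun y => v y + k) = weightedLaplacian a m v := by
  have h : fderiv ℝ (fun y => v y + k) = fderiv ℝ v := by
    ext1 y
    exact fderiv_add_const k
  ext x
  simp only [weightedLaplacian, h]

theorem rpow_mul_le_of_apply_lt (hj : j ≠ m) (hq : 2 * q = 2 - n - a) {k : ℝ}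
    (hsm : ∀ x, 0 < x m → ContDiffAt ℝ 2 v x) (hc : ContinuousOn v {x | 0 ≤ x m})
    (hL : ∀ x, 0 < x m → weightedLaplacian a m v x = 0) (hbd : ∀ x, x m = 0 → v x = k)
    (hk : (q < 0 ∧ 0 ≤ k ∧ ∀ x, 0 ≤ x m → 0 ≤ v x) ∨
      (0 ≤ q ∧ k = 0 ∧ ∃ C, ∀ x, 0 ≤ x m → -C ≤ v x))
    {y z : EuclideanSpace ℝ (Fin n)} (hz : 0 < z m) (hzy : z m < y m) :
    (y m / z m) ^ q * v z ≤ v y := by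
  have hy : 0 < y m := hz.trans hzy
  have hd : 0 < y m - z m := sub_pos.2 hzy
  -- Normalised so that `w m = 1`: the line through `z` and `y` is `c + t • w`, with `t` the height
  -- and `c` on the boundary.
  set w := (y m - z m)⁻¹ • (y - z) with hw
  set c := y - y m • w with hcdef
  have hwm : w m = 1 := by
    simp [hw, hd.ne']
  have hcm : c m = 0 := by simp [hcdef, hwm]
  have hyc : y m • w + c = y := by simp [hcdef]
  have hzc : z m • w + c = z := by
    have : (y m - z m) • w = y - z := by
      rw [hw, smul_smul, mul_inv_cancel₀ hd.ne', one_smul]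
    rw [sub_smul, sub_eq_iff_eq_add] at this
    rw [hcdef, this]
    abel
  have hwn : 0 < ‖w‖ := by
    have : w ≠ 0 := by
      intro h
      rw [h] at hwm
      simp at hwm
    positivity
  have e1 : ‖y m • w‖ ^ 2 = y m ^ 2 * ‖w‖ ^ 2 := by
    rw [norm_smul, mul_pow, Real.norm_of_nonneg hy.le]
  -- `μ` is the product of the distances from `c` to `z` and to `y`, so inversion about `c`
  -- exchanges the two points.
  have key := kelvinTransform_le (v := fun x => v (x + c)) (μ := z m * y m * ‖w‖ ^ 2) hj
    (by positivity) hq (k := k)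
    (fun x hx => (hsm (x + c) (by simpa [hcm] using hx)).comp x (by fun_prop))
    (hc.comp (by fun_prop) fun x hx => by simpa [hcm] using hx)
    (fun x hx => by
      rw [weightedLaplacian_comp_add_right c x hcm]
      exact hL _ (by simpa [hcm] using hx))
    (fun x hx => hbd _ (by simp [hcm, hx]))
    (hk.imp (fun h => ⟨h.1, h.2.1, fun x hx => h.2.2 _ (by simpa [hcm] using hx)⟩)
      fun h => ⟨h.1, h.2.1, h.2.2.imp fun C hC x hx => hC _ (by simpa [hcm] using hx)⟩)
    (x := y m • w) (by simp [hwm, hy.le])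
    (by
      rw [e1, pow_two (y m)]
      gcongr)
  rw [kelvinTransform, e1, hyc, smul_smul] at key
  rw [show y m ^ 2 * ‖w‖ ^ 2 / (z m * y m * ‖w‖ ^ 2) = y m / z m by field_simp,
    show z m * y m * ‖w‖ ^ 2 / (y m ^ 2 * ‖w‖ ^ 2) * y m = z m by field_simp, hzc] at key
  exact key

theorem eq_of_apply_eq (hj : j ≠ m) (hq : 2 * q = 2 - n - a) {k : ℝ}
    (hsm : ∀ x, 0 < x m → ContDiffAt ℝ 2 v x) (hc : ContinuousOn v {x | 0 ≤ x m})
    (hL : ∀ x, 0 < x m → weightedLaplacian a m v x = 0) (hbd : ∀ x, x m = 0 → v x = k)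
    (hk : (q < 0 ∧ 0 ≤ k ∧ ∀ x, 0 ≤ x m → 0 ≤ v x) ∨
      (0 ≤ q ∧ k = 0 ∧ ∃ C, ∀ x, 0 ≤ x m → -C ≤ v x))
    {y z : EuclideanSpace ℝ (Fin n)} (hz : 0 < z m) (hyz : y m = z m) : v y = v z := by
  suffices h : ∀ y z : EuclideanSpace ℝ (Fin n), 0 < z m → y m = z m → v z ≤ v y from
    le_antisymm (h z y (hyz ▸ hz) hyz.symm) (h y z hz hyz)
  clear! y z
  intro y z hz hyz
  have h1 : Tendsto (fun s : ℝ => ((y m + s) / z m) ^ q * v z) (𝓝[>] 0)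
      (𝓝 (((y m + 0) / z m) ^ q * v z)) := by
    refine Tendsto.mono_left ?_ nhdsWithin_le_nhds
    refine Tendsto.mul_const _ (Tendsto.rpow_const ?_ (Or.inl ?_))
    · exact Continuous.tendsto (by fun_prop) 0
    · rw [hyz, add_zero, div_self hz.ne']
      exact one_ne_zero
  have h2 : Tendsto (fun s : ℝ => v (y + s • EuclideanSpace.single m 1)) (𝓝[>] 0) (𝓝 (v y)) := by
    refine Tendsto.mono_left ?_ nhdsWithin_le_nhds
    have hc1 : ContinuousAt (fun s : ℝ => y + s • EuclideanSpace.single m (1 : ℝ)) 0 := by fun_prop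
    have hc2 : ContinuousAt v (y + (0 : ℝ) • EuclideanSpace.single m (1 : ℝ)) := by
      simpa using (hsm y (hyz ▸ hz)).continuousAt
    simpa [Function.comp_def] using (ContinuousAt.comp (f := fun s : ℝ => y + s • EuclideanSpace.single m (1 : ℝ))
      (g := v) (x := 0) hc2 hc1).tendsto
  rw [hyz, add_zero, div_self hz.ne', Real.one_rpow, one_mul] at h1
  -- Raising `y` by `s > 0` provides the strict height inequality; then `s → 0`.
  refine le_of_tendsto_of_tendsto h1 h2 (eventually_mem_nhdsWithin.mono fun s hs => ?_)
  have hs : 0 < s := hs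
  have := rpow_mul_le_of_apply_lt hj hq hsm hc hL hbd hk (z := z)
    (y := y + s • EuclideanSpace.single m 1) hz (by simp [hyz, hs])
  simpa [hyz] using this

end Translation

/-! ### The ordinary differential equation in the height -/

section OneDimensional

theorem HasTwoDerivs.snd_unique {F : Type*} [NormedAddCommGroup F] [NormedSpace ℝ F] {g : ℝ → F}
    {d₁ d₂ e₁ e₂ : F} (h : HasTwoDerivs g d₁ d₂) (h' : HasTwoDerivs g e₁ e₂) : d₂ = e₂ := by
  obtain ⟨g', hg1, -, hg2⟩ := h
  obtain ⟨g'', hg1', -, hg2'⟩ := h'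
  have : g' =ᶠ[𝓝 0] g'' := by filter_upwards [hg1, hg1'] with t h1 h2 using h1.unique h2
  exact (hg2.congr_of_eventuallyEq this.symm).unique hg2'

theorem eq_apply_one_of_hasDerivAt_zero {h : ℝ → ℝ} (hh : ∀ t, 0 < t → HasDerivAt h 0 t) {t : ℝ}
    (ht : 0 < t) : h t = h 1 :=
  isOpen_Ioi.is_const_of_deriv_eq_zero isPreconnected_Ioi
    (fun s hs => (hh s hs).differentiableAt.differentiableWithinAt) (fun s hs => (hh s hs).deriv)
    (Set.mem_Ioi.2 ht) (Set.mem_Ioi.2 one_pos)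

theorem eq_zero_of_tendsto_of_eq_add_mul {f φ : ℝ → ℝ} {c d : ℝ} (hf : ∀ t, 0 < t → f t = d + c * φ t)
    (hlim : Tendsto f (𝓝[>] 0) (𝓝 0)) (hφ : ∀ l, ¬ Tendsto φ (𝓝[>] 0) (𝓝 l)) {t : ℝ} (ht : 0 < t) :
    f t = 0 := by
  have hf' : f =ᶠ[𝓝[>] 0] fun t => d + c * φ t := eventually_mem_nhdsWithin.mono hf
  by_cases hc : c = 0
  · subst hc
    simp only [zero_mul, add_zero] at hf hf'
    rw [hf t ht]
    exact tendsto_nhds_unique (tendsto_const_nhds.congr' hf'.symm) hlim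
  · refine absurd ?_ (hφ (c⁻¹ * (0 - d)))
    refine ((hlim.sub_const d).const_mul c⁻¹).congr' ?_
    filter_upwards [hf'] with s hs
    rw [hs]
    field_simp
    ring

/-- Since `t ^ a * g t` is constant, `f` is affine in `log t` (for `a = 1`) or in `t ^ (1 - a)`. For
`a ≥ 1` this profile has no finite limit at 0, so `f = 0`. For `a < 1` the limit kills the additive
constant, and the lower bound as `t → ∞` fixes the sign. -/
theorem exists_eq_mul_rpow_of_ode {f g : ℝ → ℝ} {a : ℝ} (hf : ∀ t, 0 < t → HasDerivAt f (g t) t)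
    (hg : ∀ t, 0 < t → HasDerivAt g (-(a / t * g t)) t) (hlim : Tendsto f (𝓝[>] 0) (𝓝 0))
    (hbelow : ∃ C, ∀ t, 0 < t → -C ≤ f t) :
    ∃ C : ℝ, 0 ≤ C ∧ ∀ t, 0 < t → f t = C * t ^ (1 - a) := by
  have h1 : ∀ t : ℝ, 0 < t → HasDerivAt (fun t => t ^ a * g t) 0 t := by
    intro t ht
    refine ((Real.hasDerivAt_rpow_const (Or.inl ht.ne')).mul (hg t ht)).congr_deriv ?_
    rw [Real.rpow_sub_one ht.ne']
    field_simp
    ring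
  set c := g 1 with hcdef
  have h2 : ∀ t : ℝ, 0 < t → g t = c * t ^ (-a) := by
    intro t ht
    have := eq_apply_one_of_hasDerivAt_zero h1 ht
    simp only [Real.one_rpow, one_mul] at this
    rw [hcdef, ← this, Real.rpow_neg ht.le]
    field_simp
  by_cases ha : a = 1
  · subst ha
    have h3 : ∀ t : ℝ, 0 < t → HasDerivAt (fun t => f t - c * Real.log t) 0 t := by
      intro t ht
      refine ((hf t ht).sub ((Real.hasDerivAt_log ht.ne').const_mul c)).congr_deriv ?_
      rw [h2 t ht, Real.rpow_neg_one]
      ring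
    refine ⟨0, le_rfl, fun t ht => ?_⟩
    rw [zero_mul]
    refine eq_zero_of_tendsto_of_eq_add_mul (c := c) (φ := Real.log)
      (fun t ht => sub_eq_iff_eq_add.1 (eq_apply_one_of_hasDerivAt_zero h3 ht)) hlim
      (fun l => not_tendsto_nhds_of_tendsto_atBot Real.tendsto_log_nhdsGT_zero l) ht
  have ha' : 1 - a ≠ 0 := sub_ne_zero.2 (Ne.symm ha)
  have h3 : ∀ t : ℝ, 0 < t → HasDerivAt (fun t => f t - c / (1 - a) * t ^ (1 - a)) 0 t := by
    intro t ht
    refine ((hf t ht).sub ((Real.hasDerivAt_rpow_const (p := 1 - a)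
      (Or.inl ht.ne')).const_mul (c / (1 - a)))).congr_deriv ?_
    rw [h2 t ht, show 1 - a - 1 = -a by ring]
    field_simp
    ring
  have h4 := fun t ht => sub_eq_iff_eq_add.1 (eq_apply_one_of_hasDerivAt_zero h3 (t := t) ht)
  rcases lt_or_gt_of_ne ha with ha1 | ha1
  · have hpow : 0 < 1 - a := by linarith
    set e := c / (1 - a)
    set d := f 1 - e * 1 ^ (1 - a)
    have ht0 : Tendsto (fun t : ℝ => d + e * t ^ (1 - a)) (𝓝[>] 0) (𝓝 (d + e * 0)) := by
      refine Tendsto.const_add d (Tendsto.const_mul e ?_)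
      have := (Real.continuousAt_rpow_const 0 (1 - a) (Or.inr hpow.le)).tendsto
      rw [Real.zero_rpow ha'] at this
      exact this.mono_left nhdsWithin_le_nhds
    have hd : d = 0 := by
      have := tendsto_nhds_unique (l := 𝓝[>] (0 : ℝ)) (ht0.congr' (eventually_mem_nhdsWithin.mono fun t ht =>
        (h4 t ht).symm)) hlim
      simpa using this
    have h5 : ∀ t : ℝ, 0 < t → f t = e * t ^ (1 - a) := by
      intro t ht
      rw [h4 t ht, hd, zero_add]
    refine ⟨e, ?_, h5⟩
    by_contra! he
    obtain ⟨C, hC⟩ := hbelow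
    have hinf : Tendsto (fun t : ℝ => e * t ^ (1 - a)) atTop atBot :=
      (tendsto_rpow_atTop hpow).const_mul_atTop_of_neg he
    obtain ⟨t, ht1, ht2⟩ := ((hinf.eventually_lt_atBot (-C)).and (eventually_gt_atTop 0)).exists
    have := hC t ht2
    rw [h5 t ht2] at this
    linarith
  · refine ⟨0, le_rfl, fun t ht => ?_⟩
    rw [zero_mul]
    exact eq_zero_of_tendsto_of_eq_add_mul h4 hlim
      (fun l => not_tendsto_nhds_of_tendsto_atTop
        (tendsto_rpow_neg_nhdsGT_zero (by linarith)) l) ht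

end OneDimensional

/-! ### Divergence form and reduction to one variable -/

section HalfSpace

variable {n : ℕ} {a : ℝ} {m : Fin n} {u : EuclideanSpace ℝ (Fin n) → ℝ}

theorem gradient_apply (x : EuclideanSpace ℝ (Fin n)) (i : Fin n) :
    (∇ u x) i = fderiv ℝ u x (EuclideanSpace.single i 1) := by
  have h : inner ℝ (∇ u x) (EuclideanSpace.single i (1 : ℝ)) =
      fderiv ℝ u x (EuclideanSpace.single i 1) := by
    rw [gradient, InnerProductSpace.toDual_symm_apply]
  rw [← h, EuclideanSpace.inner_single_right]
  simp

theorem vectorDiv_weightedGradient (hn : 2 ≤ n) {x : EuclideanSpace ℝ (Fin n)}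
    (hx : 0 < x (lastIdx hn)) (hu : ContDiffAt ℝ 2 u x) :
    vectorDiv (weightedGradient hn a u) x =
      x (lastIdx hn) ^ a * weightedLaplacian a (lastIdx hn) u x := by
  set m := lastIdx hn
  have h2 : HasFDerivAt (fderiv ℝ u) (fderiv ℝ (fderiv ℝ u) x) x :=
    ((hu.fderiv_right (m := 1) (by norm_num [one_add_one_eq_two])).differentiableAt
      (by simp)).hasFDerivAt
  have hp : HasFDerivAt (fun y : EuclideanSpace ℝ (Fin n) => y m ^ a)
      ((a * x m ^ (a - 1)) • (EuclideanSpace.proj m : EuclideanSpace ℝ (Fin n) →L[ℝ] ℝ)) x := by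
    have h1 : HasDerivAt (fun s : ℝ => s ^ a) (a * x m ^ (a - 1))
        ((EuclideanSpace.proj m : EuclideanSpace ℝ (Fin n) →L[ℝ] ℝ) x) :=
      Real.hasDerivAt_rpow_const (Or.inl hx.ne')
    exact h1.comp_hasFDerivAt x
      (EuclideanSpace.proj m : EuclideanSpace ℝ (Fin n) →L[ℝ] ℝ).hasFDerivAt
  have hi : ∀ i, fderiv ℝ (fun y => weightedGradient hn a u y i) x (EuclideanSpace.single i 1) =
      x m ^ a * fderiv ℝ (fderiv ℝ u) x (EuclideanSpace.single i 1) (EuclideanSpace.single i 1) +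
      if m = i then a * x m ^ (a - 1) * fderiv ℝ u x (EuclideanSpace.single m 1) else 0 := by
    intro i
    have hfun : (fun y => weightedGradient hn a u y i) =
        fun y => y m ^ a * fderiv ℝ u y (EuclideanSpace.single i 1) := by
      ext y
      simp [weightedGradient, gradient_apply, m]
    have hd : HasFDerivAt (fun y => y m ^ a * fderiv ℝ u y (EuclideanSpace.single i 1)) _ x :=
      hp.mul (h2.clm_apply (hasFDerivAt_const (EuclideanSpace.single i (1 : ℝ)) x))
    rw [hfun, hd.fderiv]
    by_cases h : m = i
    · subst h
      simp
      ring
    · simp [h]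
  rw [vectorDiv, Finset.sum_congr rfl fun i _ => hi i, Finset.sum_add_distrib, ← Finset.mul_sum,
    Finset.sum_ite_eq, if_pos (Finset.mem_univ _), weightedLaplacian, Real.rpow_sub_one hx.ne']
  field_simp

theorem exists_eq_mul_rpow_of_apply_eq (hsm : ∀ x, 0 < x m → ContDiffAt ℝ 2 u x)
    (hc : ContinuousOn u {x | 0 ≤ x m}) (hL : ∀ x, 0 < x m → weightedLaplacian a m u x = 0)
    (hbd : ∀ x, x m = 0 → u x = 0) (hbelow : ∃ C, ∀ x, 0 < x m → -C ≤ u x)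
    (heq : ∀ y z, 0 < z m → y m = z m → u y = u z) :
    ∃ C : ℝ, 0 ≤ C ∧ ∀ x, 0 < x m → u x = C * x m ^ (1 - a) := by
  set e := EuclideanSpace.single m (1 : ℝ) with he
  have hem : ∀ t : ℝ, (t • e) m = t := fun t => by simp [he]
  have hline : ∀ t : ℝ, HasDerivAt (fun t : ℝ => t • e) e t := fun t => by
    simpa using (hasDerivAt_id t).smul_const e
  -- `u` is constant along horizontal lines, so only the `m`-th second derivative survives in the
  -- equation.
  have hpure : ∀ x, 0 < x m → ∀ i, i ≠ m →
      fderiv ℝ (fderiv ℝ u) x (EuclideanSpace.single i 1) (EuclideanSpace.single i 1) = 0 := by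
    intro x hx i hi
    have h1 := (HasTwoDerivs.line x (EuclideanSpace.single i (1 : ℝ))).comp (v := u)
      (by simpa using hsm x hx)
    have h2 : (fun t : ℝ => u (x + t • EuclideanSpace.single i (1 : ℝ))) = fun _ => u x := by
      ext t
      exact heq _ _ hx (by simp [hi.symm])
    rw [h2] at h1
    simpa using h1.snd_unique (HasTwoDerivs.const (u x))
  have hf : ∀ t : ℝ, 0 < t → HasDerivAt (fun t : ℝ => u (t • e)) (fderiv ℝ u (t • e) e) t := by
    intro t ht
    have hs := hsm (t • e) (by rwa [hem])
    exact (hs.differentiableAt (by simp)).hasFDerivAt.comp_hasDerivAt t (hline t)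
  have hg : ∀ t : ℝ, 0 < t → HasDerivAt (fun t : ℝ => fderiv ℝ u (t • e) e)
      (-(a / t * fderiv ℝ u (t • e) e)) t := by
    intro t ht
    have hs := hsm (t • e) (by rwa [hem])
    have h2 : HasFDerivAt (fderiv ℝ u) (fderiv ℝ (fderiv ℝ u) (t • e)) (t • e) :=
      ((hs.fderiv_right (m := 1) (by norm_num [one_add_one_eq_two])).differentiableAt
        (by simp)).hasFDerivAt
    have h3 : HasDerivAt (fun t : ℝ => fderiv ℝ u (t • e)) (fderiv ℝ (fderiv ℝ u) (t • e) e) t :=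
      h2.comp_hasDerivAt t (hline t)
    refine (h3.clm_apply (hasDerivAt_const t e)).congr_deriv ?_
    have h := hL (t • e) (by rwa [hem])
    rw [weightedLaplacian, hem, Finset.sum_eq_single m
      (fun i _ hi => hpure _ (by rwa [hem]) i hi) (by simp)] at h
    rw [map_zero, add_zero]
    exact eq_neg_of_add_eq_zero_left h
  have hlim : Tendsto (fun t : ℝ => u (t • e)) (𝓝[>] 0) (𝓝 0) := by
    have h0 : Tendsto (fun t : ℝ => t • e) (𝓝[>] 0) (𝓝[{x | 0 ≤ x m}] 0) := by
      refine tendsto_nhdsWithin_iff.2 ⟨?_, eventually_mem_nhdsWithin.mono fun t ht => ?_⟩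
      · have := (hline 0).continuousAt.tendsto
        rw [zero_smul] at this
        exact this.mono_left nhdsWithin_le_nhds
      · rw [Set.mem_ofPred_eq, hem]
        exact le_of_lt ht
    have h1 := (hc 0 (by simp)).tendsto.comp h0
    rwa [hbd 0 (by simp)] at h1
  obtain ⟨C, hC0, hC⟩ := exists_eq_mul_rpow_of_ode hf hg hlim
    (hbelow.imp fun C hC t ht => hC _ (by rwa [hem]))
  exact ⟨C, hC0, fun x hx => (heq _ _ (by rwa [hem]) (by rw [hem])).trans (hC _ hx)⟩

end HalfSpace

/-! ### Conclusion -/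

theorem theorem1p1 (n : ℕ) (hn : 2 ≤ n) (a : ℝ) (u : EuclideanSpace ℝ (Fin n) → ℝ)
    (hu_smooth : ContDiffOn ℝ 2 u (upperHalfSpace hn))
    (hu_cont : ContinuousOn u (closedUpperHalfSpace hn))
    (hu_eq : ∀ x ∈ upperHalfSpace hn, vectorDiv (weightedGradient hn a u) x = 0)
    (hu_below : ∃ C : ℝ, ∀ x ∈ upperHalfSpace hn, -C < u x)
    (hu_bdry : ∀ x ∈ upperHalfSpaceBoundary hn, u x = 0) :
    ∃ C : ℝ, 0 ≤ C ∧ ∀ x ∈ upperHalfSpace hn, u x = C * (x (lastIdx hn)) ^ (1 - a) := by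
  have hopen : IsOpen (upperHalfSpace hn) := isOpen_lt continuous_const (by fun_prop)
  have hsm : ∀ x, 0 < x (lastIdx hn) → ContDiffAt ℝ 2 u x := fun x hx =>
    hu_smooth.contDiffAt (hopen.mem_nhds hx)
  have hL : ∀ x, 0 < x (lastIdx hn) → weightedLaplacian a (lastIdx hn) u x = 0 := by
    intro x hx
    have h := hu_eq x hx
    rw [vectorDiv_weightedGradient hn hx (hsm x hx)] at h
    exact (mul_eq_zero.1 h).resolve_left (Real.rpow_pos_of_pos hx a).ne'
  obtain ⟨C, hC⟩ := hu_below
  have hC' : ∀ x, 0 ≤ x (lastIdx hn) → -|C| ≤ u x := by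
    intro x hx
    rcases hx.eq_or_lt with h | h
    · rw [hu_bdry x h.symm]
      simp
    · exact (neg_le_neg (le_abs_self C)).trans (hC x h).le
  have hj : (⟨0, by omega⟩ : Fin n) ≠ lastIdx hn := by
    intro h
    have := congrArg Fin.val h
    simp only [lastIdx] at this
    omega
  refine exists_eq_mul_rpow_of_apply_eq hsm hu_cont hL hu_bdry ⟨C, fun x hx => (hC x hx).le⟩
    fun y z hz hyz => ?_
  obtain ⟨q, hq⟩ : ∃ q : ℝ, 2 * q = 2 - n - a := ⟨(2 - n - a) / 2, by ring⟩
  -- For `q < 0` the comparison needs a nonnegative solution, so `|C|` is added; the resulting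
  -- boundary value is harmless because the Kelvin factor is at most 1 outside the sphere. For `q ≥
  -- 0` the boundary value must stay 0, and `u` is used unshifted.
  rcases lt_or_ge q 0 with hq0 | hq0
  · refine add_right_cancel (b := |C|) (eq_of_apply_eq (v := fun x => u x + |C|) (k := |C|) hj hq
      (fun x hx => (hsm x hx).add contDiffAt_const) (hu_cont.add continuousOn_const)
      (fun x hx => ?_) (fun x hx => ?_) (Or.inl ⟨hq0, abs_nonneg C, fun x hx => ?_⟩) hz hyz)
    · rw [weightedLaplacian_add_const, hL x hx]
    · rw [hu_bdry x hx, zero_add]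
    · linarith [hC' x hx]
  · exact eq_of_apply_eq hj hq hsm hu_cont hL hu_bdry (Or.inr ⟨hq0, rfl, |C|, hC'⟩) hz hyz
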